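/- Let $A \in \mathbb{R}^{m \times n}$ and $b \in \mathbb{R}^m$ be such that the polyhedron $\mathcal{P} = \{x \in \mathbb{R}^n : Ax \ge b\}$ is a polytope (i.e. bounded). A face of $\mathcal{P}$ is a nonempty set of the form $\{x \in \mathcal{P} : \langle c, x\rangle \le \langle c, y\rangle \text{ for all } y \in \mathcal{P}\}$ with $c \in \mathbb{R}^n$; vertices and edges are the faces of dimension $0$ and $1$. The vertex-edge graph $G_{\mathrm{vert}}$ of $\mathcal{P}$ is the graph on the vertices of $\mathcal{P}$ in which $v$ and $w$ are adjacent when the segment $[v,w]$ is an edge of $\mathcal{P}$. Let $\widetilde b = [\, b \;\; -\mathrm{Id}_m \,] \in \mathbb{R}^{m \times (1+m)}$. For $I \subset \{1,\dots,m\}$, let $M_I$ denote the submatrix of $M$ formed by the rows with index in $I$. A lex-feasible basis is a set $I \subset \{1,\dots,m\}$ of cardinality $n$ such that $A_I$ is nonsingular and the matrix $X^I = A_I^{-1}\, \widetilde b_I \in \mathbb{R}^{n \times (1+m)}$ satisfies $A X^I \ge_{\mathrm{lex}} \widetilde b$, meaning that each row of $A X^I$ is greater than or equal to the corresponding row of $\widetilde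 b$ in the lexicographic order. Let $G_{\mathrm{lex}}$ be the graph on the lex-feasible bases in which $I$ and $J$ are adjacent when $\#(I \cap J) = n-1$. For a matrix $X$, let $\pi(X)$ be its first column, and let $\phi(I) = \pi(X^I)$. Then $G_{\mathrm{vert}}$ is the image of $G_{\mathrm{lex}}$ by $\phi$: the vertices of $\mathcal{P}$ are exactly the points $\phi(I)$ where $I$ is a lex-feasible basis, and the pairs of adjacent vertices of $\mathcal{P}$ are exactly the pairs $(\phi(I), \phi(J))$ where $I$ and $J$ are adjacent lex-feasible bases with $\phi(I) \ne \phi(J)$. -/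

import Mathlib

namespace LexGraph

open Matrix

/-! ### Undirected graphs with an explicit vertex set, and their images -/

/-- An undirected graph `(V, E)` whose vertex set `V` is a set of elements of `α`. -/
@[ext]
structure UGraph (α : Type*) where
  /-- the vertex set -/
  verts : Set α
  /-- the adjacency relation, i.e. the edge set -/
  Adj : α → α → Prop
  mem_of_adj : ∀ {v w : α}, Adj v w → v ∈ verts
  symm : ∀ {v w : α}, Adj v w → Adj w v

/-- The image `f(G)`: its vertices are the `f v` for `v` a vertex of `G`, and its edges the pairs
`(f v, f w)` with `(v, w)` an edge of `G` and `f v ≠ f w`. -/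
def UGraph.image {α β : Type*} (f : α → β) (G : UGraph α) : UGraph β where
  verts := f '' G.verts
  Adj x y := ∃ v w, G.Adj v w ∧ f v ≠ f w ∧ f v = x ∧ f w = y
  mem_of_adj := by
    rintro x y ⟨v, w, h, -, rfl, rfl⟩
    exact ⟨v, G.mem_of_adj h, rfl⟩
  symm := by
    rintro x y ⟨v, w, h, hne, rfl, rfl⟩
    exact ⟨w, v, G.symm h, hne.symm, rfl, rfl⟩

/-! ### Polyhedra, faces, and the vertex-edge graph -/

/-- The polyhedron `{x : A x ≥ b}`. -/
def polyhedron {m n : ℕ} (A : Matrix (Fin m) (Fin n) ℝ) (b : Fin m → ℝ) : Set (Fin n → ℝ) :=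
  {x | ∀ i, b i ≤ (A *ᵥ x) i}

/-- `F` is a (nonempty) face of `P`: the set of points of `P` minimizing some linear function. -/
def IsFace {n : ℕ} (P F : Set (Fin n → ℝ)) : Prop :=
  F.Nonempty ∧ ∃ c : Fin n → ℝ, F = {x | x ∈ P ∧ ∀ y ∈ P, c ⬝ᵥ x ≤ c ⬝ᵥ y}

/-- `F` is a face of `P` whose affine hull has dimension `d`. -/
def IsFaceOfDim {n : ℕ} (P : Set (Fin n → ℝ)) (d : ℕ) (F : Set (Fin n → ℝ)) : Prop :=
  IsFace P F ∧ Module.finrank ℝ (affineSpan ℝ F).direction = d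

/-- `v` is a vertex of `P`: the singleton `{v}` is a face of dimension `0`. -/
def IsVertex {n : ℕ} (P : Set (Fin n → ℝ)) (v : Fin n → ℝ) : Prop :=
  IsFaceOfDim P 0 {v}

/-- The vertex-edge graph of `P`: two vertices are adjacent when the line segment between them is
an edge of `P`, i.e. a face of dimension `1` (in particular they are distinct). -/
def vertexEdgeGraph {n : ℕ} (P : Set (Fin n → ℝ)) : UGraph (Fin n → ℝ) where
  verts := {v | IsVertex P v}
  Adj v w := IsVertex P v ∧ IsVertex P w ∧ IsFaceOfDim P 1 (segment ℝ v w)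
  mem_of_adj h := h.1
  symm := by
    rintro v w ⟨hv, hw, h⟩
    exact ⟨hw, hv, by rwa [segment_symm]⟩

/-! ### Lex-feasible bases and the lex-graph -/

/-- The subsets of `{1, …, m}` of cardinality `n`. -/
abbrev RowSet (m n : ℕ) : Type := {I : Finset (Fin m) // I.card = n}

/-- The submatrix `M_I` formed by the rows of `M` with index in `I`, in increasing order. -/
def rows {m n q : ℕ} (M : Matrix (Fin m) (Fin q) ℝ) (I : RowSet m n) : Matrix (Fin n) (Fin q) ℝ :=
  M.submatrix (I.1.orderEmbOfFin I.2) id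

/-- The perturbed right-hand side `[b  -Id]`, with `1 + m` columns: the `i`-th row encodes the
polynomial `b_i - ε^i`. -/
def perturbed {m : ℕ} (b : Fin m → ℝ) : Matrix (Fin m) (Fin (m + 1)) ℝ :=
  Matrix.of fun i => Fin.cons (b i) ((-1 : Matrix (Fin m) (Fin m) ℝ) i)

/-- `Y ≤_lex X`: every row of `Y` is lexicographically at most the corresponding row of `X`. -/
def LexLE {p q : ℕ} (Y X : Matrix (Fin p) (Fin q) ℝ) : Prop :=
  ∀ i, toLex (Y i) ≤ toLex (X i)

/-- The perturbed basic point `X^I = A_I⁻¹ b̃_I` (meaningful when `A_I` is nonsingular). -/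
noncomputable def basicPoint {m n : ℕ} (A : Matrix (Fin m) (Fin n) ℝ) (b : Fin m → ℝ)
    (I : RowSet m n) : Matrix (Fin n) (Fin (m + 1)) ℝ :=
  (rows A I)⁻¹ * rows (perturbed b) I

/-- `I` is a lex-feasible basis: `A_I` is nonsingular and `A X^I ≥_lex b̃`. -/
def IsLexFeasibleBasis {m n : ℕ} (A : Matrix (Fin m) (Fin n) ℝ) (b : Fin m → ℝ)
    (I : RowSet m n) : Prop :=
  IsUnit (rows A I) ∧ LexLE (perturbed b) (A * basicPoint A b I)

/-- The graph of lex-feasible bases: `I` and `J` are adjacent when `#(I ∩ J) = n - 1`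
(written as `#(I ∩ J) + 1 = n`, so that there is no edge when `n = 0`). -/
def lexGraph {m n : ℕ} (A : Matrix (Fin m) (Fin n) ℝ) (b : Fin m → ℝ) : UGraph (RowSet m n) where
  verts := {I | IsLexFeasibleBasis A b I}
  Adj I J := IsLexFeasibleBasis A b I ∧ IsLexFeasibleBasis A b J ∧ (I.1 ∩ J.1).card + 1 = n
  mem_of_adj h := h.1
  symm := by
    rintro I J ⟨hI, hJ, h⟩
    exact ⟨hJ, hI, by rwa [Finset.inter_comm]⟩

/-- The first (unperturbed) column `π(X)` of a perturbed point `X`. -/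
def unperturb {m n : ℕ} (X : Matrix (Fin n) (Fin (m + 1)) ℝ) : Fin n → ℝ := fun j => X j 0

end LexGraph

/-!
A row of the perturbed system is an inequality in the space `ℝ^(1+m)` with the lexicographic order,
which is an ordered real vector space. Linear inequalities with real coefficients and right-hand
sides in such a space obey the ratio test (`exists_step_tight`): from a feasible point one can move
along a real direction, by an amount that is itself a vector of `ℝ^(1+m)`, until a new constraint is
tight. Hence a feasible system has a solution at which a basis of the span of its rows is tight
(`exists_basic_solution`), and `n` independent rows tight at a feasible point are a lex-feasible
basis (`isLexFeasibleBasis_of_tight`).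

Lex-feasible bases give vertices and edges because the constraints indexed by `I`, or by `I ∩ J`,
are tight on a face of the polyhedron: for `I` this face is a point (`IsLexFeasibleBasis.isVertex`),
and for `I ∩ J` it lies on a line, where the two remaining constraints bound it by the two basic
points (`isFaceOfDim_segment`).

Conversely, let `p` be a vertex, or the midpoint of an edge. Applying `exists_basic_solution` to the
perturbed constraints that are tight at `p` gives a point over `p` that is feasible for the whole
perturbed system, since the other constraints are strict already in the first coordinate
(`exists_perturbed_lift`). Its independent tight rows span the rows tight at `p`. For a vertex these
are `n` rows, hence a basis (`exists_basis_of_isVertex`). For an edge they are `n - 1` rows, and the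
ratio test along the edge in each of the two directions adds one row, giving adjacent bases over the
two endpoints (`exists_basis_of_isFace_segment`, `exists_adjacent_bases`).
-/

namespace LexGraph

open Matrix Filter Topology

/-! ### Linear inequalities over an ordered vector space -/

section OrderedModule

variable {V ι : Type*} {n : ℕ} [AddCommGroup V] [Module ℝ V]

/-- The value `⟨a, x⟩ = ∑ j, a j • x j` of the linear form with real coefficients `a` at a point `x`
with coordinates in a real vector space `V`. -/
def rowEval (a : Fin n → ℝ) (x : Fin n → V) : V := ∑ j, a j • x j

theorem rowEval_add_smul (a : Fin n → ℝ) (x : Fin n → V) (d : Fin n → ℝ) (t : V) :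
    rowEval a (fun j => x j + d j • t) = rowEval a x + (a ⬝ᵥ d) • t := by
  simp [rowEval, dotProduct, Finset.sum_add_distrib, Finset.sum_smul, smul_smul]

variable [LinearOrder V] [IsOrderedAddMonoid V]

/-- The ratio test. Moving from a feasible point `x` in a direction `d` that decreases some
constraint, one can stop at a feasible point where one of the decreasing constraints is tight. -/
theorem exists_step_tight [PosSMulMono ℝ V] (A : ι → Fin n → ℝ) (β : ι → V) (S : Finset ι)
    (x : Fin n → V) (hx : ∀ i ∈ S, β i ≤ rowEval (A i) x) (d : Fin n → ℝ)
    (hd : ∃ i ∈ S, A i ⬝ᵥ d < 0) :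
    ∃ t : V, (∀ i ∈ S, β i ≤ rowEval (A i) (fun j => x j + d j • t)) ∧
      ∃ i ∈ S, A i ⬝ᵥ d < 0 ∧ rowEval (A i) (fun j => x j + d j • t) = β i := by
  classical
  obtain ⟨i₁, hi₁, hneg₁⟩ := hd
  obtain ⟨i, hi, hmin⟩ := Finset.exists_min_image (S.filter fun i => A i ⬝ᵥ d < 0)
    (fun i => (-(A i ⬝ᵥ d))⁻¹ • (rowEval (A i) x - β i)) ⟨i₁, by simp [hi₁, hneg₁]⟩
  simp only [Finset.mem_filter] at hi hmin
  have ht : 0 ≤ (-(A i ⬝ᵥ d))⁻¹ • (rowEval (A i) x - β i) :=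
    smul_nonneg (inv_nonneg.2 (by linarith [hi.2])) (sub_nonneg.2 (hx i hi.1))
  refine ⟨(-(A i ⬝ᵥ d))⁻¹ • (rowEval (A i) x - β i), fun k hk => ?_, i, hi.1, hi.2, ?_⟩
  · rw [rowEval_add_smul]
    rcases lt_or_ge (A k ⬝ᵥ d) 0 with hneg | hpos
    · have h := smul_le_smul_of_nonneg_left (hmin k ⟨hk, hneg⟩) (by linarith : 0 ≤ -(A k ⬝ᵥ d))
      rw [smul_inv_smul₀ (by linarith), neg_smul, neg_le_sub_iff_le_add] at h
      exact h
    · exact (hx k hk).trans (le_add_of_nonneg_right (smul_nonneg hpos ht))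
  · rw [rowEval_add_smul]
    have hne : A i ⬝ᵥ d ≠ 0 := hi.2.ne
    rw [smul_smul, inv_neg, mul_neg, mul_inv_cancel₀ hne]
    simp

/-- A vector outside a subspace of `ℝⁿ` is separated from it by a vector orthogonal to the
subspace, with a strictly negative product. -/
theorem exists_dotProduct_neg_of_notMem {p : Submodule ℝ (Fin n → ℝ)} {a : Fin n → ℝ}
    (ha : a ∉ p) : ∃ z : Fin n → ℝ, (∀ y ∈ p, y ⬝ᵥ z = 0) ∧ a ⬝ᵥ z < 0 := by
  obtain ⟨f, hfa, hfp⟩ := Submodule.exists_le_ker_of_notMem ha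
  have key : ∀ y, y ⬝ᵥ (fun j => f (Pi.single j 1)) = f y := fun y => by
    rw [LinearMap.pi_apply_eq_sum_univ f y]
    simp only [dotProduct, smul_eq_mul]
    refine Finset.sum_congr rfl fun j _ => ?_
    congr 2
    ext k
    simp [Pi.single_apply, eq_comm]
  rcases lt_or_gt_of_ne hfa with h | h
  · exact ⟨_, fun y hy => (key y).trans (hfp hy), (key a).trans_lt h⟩
  · refine ⟨-fun j => f (Pi.single j 1), fun y hy => ?_, ?_⟩
    · rw [dotProduct_neg, key, hfp hy, neg_zero]
    · rw [dotProduct_neg, key]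
      linarith

/-- A feasible system of inequalities over an ordered vector space has a basic solution: a feasible
point whose tight rows contain a basis of the span of all the rows. -/
theorem exists_basic_solution [PosSMulMono ℝ V] (A : ι → Fin n → ℝ) (β : ι → V) (S : Finset ι)
    (hS : ∃ x : Fin n → V, ∀ i ∈ S, β i ≤ rowEval (A i) x) :
    ∃ x : Fin n → V, (∀ i ∈ S, β i ≤ rowEval (A i) x) ∧ ∃ H ⊆ S,
      (∀ i ∈ H, rowEval (A i) x = β i) ∧ LinearIndepOn ℝ A (H : Set ι) ∧
      ∀ i ∈ S, A i ∈ Submodule.span ℝ (A '' H) := by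
  classical
  -- Among all feasible points, take one with the largest number of tight rows.
  let N : Set ℕ := {k | ∃ x : Fin n → V, (∀ i ∈ S, β i ≤ rowEval (A i) x) ∧
    (S.filter fun i => rowEval (A i) x = β i).card = k}
  have hN : N.Nonempty := hS.imp' (fun x => _) fun x hx => ⟨x, hx, rfl⟩
  have hbdd : BddAbove N := ⟨S.card, by rintro _ ⟨x, -, rfl⟩; exact Finset.card_filter_le _ _⟩
  obtain ⟨x, hx, hcard⟩ := Nat.sSup_mem hN hbdd
  set T := S.filter fun i => rowEval (A i) x = β i with hT
  have hspan : ∀ i ∈ S, A i ∈ Submodule.span ℝ (A '' T) := by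
    by_contra! hcon
    obtain ⟨i, hiS, hi⟩ := hcon
    obtain ⟨z, hz, hiz⟩ := exists_dotProduct_neg_of_notMem hi
    obtain ⟨t, hfeas, k, hkS, hkz, hk⟩ := exists_step_tight A β S x hx z ⟨i, hiS, hiz⟩
    have hTz : ∀ l ∈ T, A l ⬝ᵥ z = 0 := fun l hl =>
      hz _ (Submodule.subset_span ⟨l, hl, rfl⟩)
    have hkT : k ∉ T := fun h => hkz.ne (hTz k h)
    have hsub : insert k T ⊆ S.filter fun i => rowEval (A i) (fun j => x j + z j • t) = β i := by
      intro l hl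
      rcases Finset.mem_insert.1 hl with rfl | hl
      · exact Finset.mem_filter.2 ⟨hkS, hk⟩
      · have := Finset.mem_filter.1 hl
        refine Finset.mem_filter.2 ⟨this.1, ?_⟩
        rw [rowEval_add_smul, hTz l hl, zero_smul, add_zero, this.2]
    have h1 := Finset.card_le_card hsub
    rw [Finset.card_insert_of_notMem hkT, hcard] at h1
    have h2 := le_csSup hbdd ⟨_, hfeas, rfl⟩
    omega
  obtain ⟨H, hHT, -, hTH, hind⟩ := exists_linearIndepOn_extension (K := ℝ) (v := A)
    (linearIndepOn_empty ℝ A) (Set.empty_subset (T : Set ι))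
  lift H to Finset ι using T.finite_toSet.subset hHT
  have hHT' : H ⊆ T := hHT
  exact ⟨x, hx, H, hHT'.trans (Finset.filter_subset _ _),
    fun i hi => (Finset.mem_filter.1 (hHT' hi)).2, hind,
    fun i hi => Submodule.span_le.2 hTH (hspan i hi)⟩

end OrderedModule

/-! ### Lex-feasible bases as basic solutions -/

instance {q : ℕ} : PosSMulMono ℝ (Lex (Fin q → ℝ)) where
  smul_le_smul_of_nonneg_left c hc x y hxy := by
    rcases hc.eq_or_lt with rfl | hc
    · simp
    rcases hxy.eq_or_lt with rfl | ⟨i, hi, hlt⟩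
    · rfl
    refine le_of_lt ⟨i, fun j hj => ?_, mul_lt_mul_of_pos_left hlt hc⟩
    exact congrArg (c * ·) (hi j hj)

variable {m n : ℕ} {A : Matrix (Fin m) (Fin n) ℝ} {b : Fin m → ℝ}

theorem isUnit_rows_iff {I : RowSet m n} :
    IsUnit (rows A I) ↔ LinearIndepOn ℝ A (I.1 : Set (Fin m)) := by
  rw [← linearIndependent_rows_iff_isUnit, ← Finset.range_orderEmbOfFin I.1 I.2]
  exact (linearIndepOn_range_iff (I.1.orderEmbOfFin I.2).injective A).symm

theorem forall_mem_iff_orderEmbOfFin {I : RowSet m n} {p : Fin m → Prop} :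
    (∀ i ∈ I.1, p i) ↔ ∀ k, p (I.1.orderEmbOfFin I.2 k) := by
  rw [← Set.forall_mem_range (p := p), Finset.range_orderEmbOfFin]
  rfl

theorem eq_of_dotProduct_eq {I : RowSet m n} (hI : IsUnit (rows A I)) {x y : Fin n → ℝ}
    (h : ∀ i ∈ I.1, A i ⬝ᵥ x = A i ⬝ᵥ y) : x = y :=
  mulVec_injective_iff_isUnit.2 hI (funext (forall_mem_iff_orderEmbOfFin.1 h))

/-- The basic point of `I` is the only solution of the perturbed equations indexed by `I`. -/
theorem mul_row_eq_iff {I : RowSet m n} (hI : IsUnit (rows A I))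
    {X : Matrix (Fin n) (Fin (m + 1)) ℝ} :
    (∀ i ∈ I.1, (A * X) i = perturbed b i) ↔ X = basicPoint A b I := by
  have hdet := (isUnit_iff_isUnit_det _).1 hI
  rw [forall_mem_iff_orderEmbOfFin, ← funext_iff]
  change rows A I * X = rows (perturbed b) I ↔ _
  constructor
  · intro h
    rw [basicPoint, ← h, nonsing_inv_mul_cancel_left _ _ hdet]
  · rintro rfl
    rw [basicPoint, mul_nonsing_inv_cancel_left _ _ hdet]

theorem mul_row_eq_rowEval (X : Matrix (Fin n) (Fin (m + 1)) ℝ) (i : Fin m) :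
    toLex ((A * X) i) = rowEval (A i) (fun j => toLex (X j)) := by
  refine funext fun k => ?_
  rw [rowEval]
  exact (Finset.sum_apply k Finset.univ fun j => A i j • X j).symm

/-- A linearly independent set of `n` rows that is tight at a feasible perturbed point is a
lex-feasible basis, and the point is its basic point. -/
theorem isLexFeasibleBasis_of_tight {X : Matrix (Fin n) (Fin (m + 1)) ℝ}
    (hX : ∀ i, toLex (perturbed b i) ≤ rowEval (A i) (fun j => toLex (X j))) {I : RowSet m n}
    (hI : LinearIndepOn ℝ A (I.1 : Set (Fin m)))
    (htight : ∀ i ∈ I.1, rowEval (A i) (fun j => toLex (X j)) = toLex (perturbed b i)) :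
    IsLexFeasibleBasis A b I ∧ basicPoint A b I = X := by
  have hu := isUnit_rows_iff.2 hI
  have h := (mul_row_eq_iff hu).1 fun i hi =>
    toLex.injective ((mul_row_eq_rowEval X i).trans (htight i hi))
  refine ⟨⟨hu, fun i => ?_⟩, h.symm⟩
  rw [← h, mul_row_eq_rowEval]
  exact hX i

/-! ### From lex-feasible bases to vertices and edges -/

theorem dotProduct_unperturb_ge {X : Matrix (Fin n) (Fin (m + 1)) ℝ} {i : Fin m}
    (h : toLex (perturbed b i) ≤ toLex ((A * X) i)) : b i ≤ A i ⬝ᵥ unperturb X :=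
  Pi.apply_le_of_toLex (i := 0) h fun j hj => absurd hj (Fin.not_lt_zero j)

theorem dotProduct_unperturb_basicPoint {I : RowSet m n} (hI : IsUnit (rows A I)) {i : Fin m}
    (hi : i ∈ I.1) : A i ⬝ᵥ unperturb (basicPoint A b I) = b i :=
  congrFun ((mul_row_eq_iff hI).2 rfl i hi) 0

theorem IsLexFeasibleBasis.unperturb_mem {I : RowSet m n} (hI : IsLexFeasibleBasis A b I) :
    unperturb (basicPoint A b I) ∈ polyhedron A b :=
  fun i => dotProduct_unperturb_ge (hI.2 i)

/-- If the constraints indexed by `K` are simultaneously tight at a point of the polyhedron, then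
the points of the polyhedron where they are tight form a face. -/
theorem isFace_of_tight (K : Finset (Fin m)) {p : Fin n → ℝ} (hp : p ∈ polyhedron A b)
    (hpK : ∀ i ∈ K, A i ⬝ᵥ p = b i) :
    IsFace (polyhedron A b) {x | x ∈ polyhedron A b ∧ ∀ i ∈ K, A i ⬝ᵥ x = b i} := by
  refine ⟨⟨p, hp, hpK⟩, ∑ i ∈ K, A i, Set.ext fun x => and_congr_right fun hx => ?_⟩
  have hsum : ∀ y, (∑ i ∈ K, A i) ⬝ᵥ y = ∑ i ∈ K, A i ⬝ᵥ y := fun y => sum_dotProduct K A y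
  simp only [hsum]
  constructor
  · intro h y hy
    rw [Finset.sum_congr rfl h]
    exact Finset.sum_le_sum fun i _ => hy i
  · intro h i hi
    refine ((Finset.sum_eq_sum_iff_of_le fun i _ => hx i).1 (le_antisymm ?_ ?_) i hi).symm
    · exact Finset.sum_le_sum fun i _ => hx i
    · rw [← Finset.sum_congr rfl hpK]
      exact h p hp

/-- The sum of the rows in `I` is minimized over the polyhedron at the basic point only. -/
theorem IsLexFeasibleBasis.isVertex {I : RowSet m n} (hI : IsLexFeasibleBasis A b I) :
    IsVertex (polyhedron A b) (unperturb (basicPoint A b I)) := by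
  refine ⟨?_, by simp [direction_affineSpan]⟩
  convert! isFace_of_tight I.1 hI.unperturb_mem
    fun i hi => dotProduct_unperturb_basicPoint hI.1 hi
  refine Set.ext fun x => ⟨?_, fun hx => ?_⟩
  · rintro rfl
    exact ⟨hI.unperturb_mem, fun i hi => dotProduct_unperturb_basicPoint hI.1 hi⟩
  · refine eq_of_dotProduct_eq hI.1 fun i hi => ?_
    rw [hx.2 i hi, dotProduct_unperturb_basicPoint hI.1 hi]

theorem convex_polyhedron : Convex ℝ (polyhedron A b) := by
  intro x hx y hy s t hs ht hst i
  rw [mulVec_add, mulVec_smul, mulVec_smul]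
  simp only [Pi.add_apply, Pi.smul_apply, smul_eq_mul]
  calc b i = s * b i + t * b i := by rw [← add_mul, hst, one_mul]
    _ ≤ _ := add_le_add (mul_le_mul_of_nonneg_left (hx i) hs) (mul_le_mul_of_nonneg_left (hy i) ht)

/-- The common constraints of two adjacent bases cut out the segment between their basic points:
the constraint dropped from either basis bounds the line on its side. -/
theorem isFaceOfDim_segment {I J : RowSet m n} (hI : IsLexFeasibleBasis A b I)
    (hJ : IsLexFeasibleBasis A b J) (hIJ : (I.1 ∩ J.1).card + 1 = n)
    (hne : unperturb (basicPoint A b I) ≠ unperturb (basicPoint A b J)) :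
    IsFaceOfDim (polyhedron A b) 1
      (segment ℝ (unperturb (basicPoint A b I)) (unperturb (basicPoint A b J))) := by
  have hvI := fun i (hi : i ∈ I.1) => dotProduct_unperturb_basicPoint (b := b) hI.1 hi
  have hwJ := fun i (hi : i ∈ J.1) => dotProduct_unperturb_basicPoint (b := b) hJ.1 hi
  have hvP := hI.unperturb_mem
  have hwP := hJ.unperturb_mem
  set v := unperturb (basicPoint A b I)
  set w := unperturb (basicPoint A b J)
  have hcard : ∀ {I J : RowSet m n}, (I.1 ∩ J.1).card + 1 = n → ∃ i ∈ I.1, ∀ k ∈ I.1,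
      k = i ∨ k ∈ J.1 := by
    intro I J h
    have h1 := Finset.card_sdiff_add_card_inter I.1 J.1
    rw [I.2] at h1
    obtain ⟨i, hi⟩ := Finset.card_eq_one.1 (by omega : (I.1 \ J.1).card = 1)
    simp only [Finset.ext_iff, Finset.mem_sdiff, Finset.mem_singleton] at hi
    exact ⟨i, ((hi i).2 rfl).1, fun k hk => or_iff_not_imp_right.2 fun h => (hi k).1 ⟨hk, h⟩⟩
  obtain ⟨i, hiI, hi⟩ := hcard hIJ
  obtain ⟨j, hjJ, hj⟩ := hcard (I := J) (J := I) (by rwa [Finset.inter_comm])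
  have hiw : b i < A i ⬝ᵥ w := by
    refine lt_of_le_of_ne (hwP i) fun h => hne (eq_of_dotProduct_eq hI.1 fun k hk => ?_)
    rcases hi k hk with rfl | hkJ
    · rw [hvI _ hk, h]
    · rw [hvI k hk, hwJ k hkJ]
  have hjv : b j < A j ⬝ᵥ v := by
    refine lt_of_le_of_ne (hvP j) fun h => hne (eq_of_dotProduct_eq hJ.1 fun k hk => ?_)
    rcases hj k hk with rfl | hkI
    · rw [hwJ _ hk, h]
    · rw [hvI k hkI, hwJ k hk]
  refine ⟨?_, ?_⟩
  · convert! isFace_of_tight (I.1 ∩ J.1) hvP fun k hk => hvI k (Finset.mem_inter.1 hk).1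
    refine Set.ext fun x => ⟨?_, fun ⟨hxP, hx⟩ => ?_⟩
    · intro hx
      refine ⟨convex_polyhedron.segment_subset hvP hwP hx, fun k hk => ?_⟩
      obtain ⟨s, t, -, -, hst, rfl⟩ := hx
      have hk := Finset.mem_inter.1 hk
      rw [dotProduct_add, dotProduct_smul, dotProduct_smul, hvI k hk.1, hwJ k hk.2, ← add_smul,
        hst, one_smul]
    · have hden : 0 < A i ⬝ᵥ w - b i := sub_pos.2 hiw
      have hxi : b i ≤ A i ⬝ᵥ x := hxP i
      -- `s` is the position of `x` on the line, read off from the constraint `i`.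
      obtain ⟨s, hs⟩ : ∃ s, s = (A i ⬝ᵥ x - b i) / (A i ⬝ᵥ w - b i) := ⟨_, rfl⟩
      have hs0 : 0 ≤ s := hs ▸ div_nonneg (by linarith) hden.le
      have hxs : x = v + s • (w - v) := by
        refine eq_of_dotProduct_eq hI.1 fun k hk => ?_
        rw [dotProduct_add, dotProduct_smul, dotProduct_sub, hvI k hk]
        rcases hi k hk with rfl | hkJ
        · rw [hs, smul_eq_mul, div_mul_cancel₀ _ hden.ne']
          ring
        · rw [hwJ k hkJ, hx k (Finset.mem_inter.2 ⟨hk, hkJ⟩)]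
          simp
      have hs1 : s ≤ 1 := by
        have hxj : b j ≤ A j ⬝ᵥ x := hxP j
        rw [hxs, dotProduct_add, dotProduct_smul, dotProduct_sub, hwJ j hjJ, smul_eq_mul] at hxj
        nlinarith
      rw [segment_eq_image']
      exact ⟨s, ⟨hs0, hs1⟩, hxs.symm⟩
  · rw [direction_affineSpan, vectorSpan_segment]
    exact finrank_span_singleton (sub_ne_zero.2 hne.symm)

/-! ### From vertices and edges to lex-feasible bases -/

/-- From a point `p` of a face, one can move a little inside the face along any direction orthogonal
to the constraints that are tight at `p`. -/
theorem IsFace.exists_pos_add_smul_mem {F : Set (Fin n → ℝ)} (hF : IsFace (polyhedron A b) F)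
    {p z : Fin n → ℝ} (hp : p ∈ F) (hz : ∀ i, A i ⬝ᵥ p = b i → A i ⬝ᵥ z = 0) :
    ∃ ε : ℝ, 0 < ε ∧ p + ε • z ∈ F := by
  obtain ⟨-, c, rfl⟩ := hF
  have hnear : ∀ z : Fin n → ℝ, (∀ i, A i ⬝ᵥ p = b i → A i ⬝ᵥ z = 0) →
      ∀ᶠ ε : ℝ in 𝓝[>] 0, p + ε • z ∈ polyhedron A b := by
    intro z hz
    refine nhdsWithin_le_nhds (eventually_all.2 fun i => ?_)
    simp only [mulVec, dotProduct_add, dotProduct_smul, smul_eq_mul]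
    rcases (hp.1 i).eq_or_lt with h | h
    · refine Eventually.of_forall fun ε => ?_
      rw [hz i h.symm, mul_zero, add_zero]
      exact h.le
    · have : Tendsto (fun ε : ℝ => A i ⬝ᵥ p + ε * (A i ⬝ᵥ z)) (𝓝 0) (𝓝 (A i ⬝ᵥ p + 0 * _)) :=
        Continuous.tendsto (by fun_prop) 0
      rw [zero_mul, add_zero] at this
      exact (this.eventually (lt_mem_nhds h)).mono fun ε hε => le_of_lt hε
  obtain ⟨ε, ⟨h1, h2⟩, hε⟩ := ((hnear z hz).and (hnear (-z) fun i hi => by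
    rw [dotProduct_neg, hz i hi, neg_zero])).and self_mem_nhdsWithin |>.exists
  have h3 := hp.2 _ h2
  rw [smul_neg, dotProduct_add, dotProduct_neg] at h3
  refine ⟨ε, hε, h1, fun y hy => ?_⟩
  rw [dotProduct_add]
  linarith [hp.2 y hy]

/-- The perturbation only relaxes the constraints: `b i - ε ^ i ≤ b i`. -/
theorem toLex_perturbed_le (i : Fin m) :
    toLex (perturbed b i) ≤ toLex (Fin.cons (b i) 0 : Fin (m + 1) → ℝ) := by
  refine Pi.toLex_monotone fun k => ?_
  refine Fin.cases ?_ (fun k => ?_) k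
  · simp [perturbed]
  · change -(1 : Matrix (Fin m) (Fin m) ℝ) i k ≤ 0
    rw [one_apply]
    split_ifs <;> simp

theorem rowEval_apply_zero (a : Fin n → ℝ) (x : Fin n → Lex (Fin (m + 1) → ℝ)) :
    rowEval a x 0 = a ⬝ᵥ fun j => x j 0 :=
  Finset.sum_apply (0 : Fin (m + 1)) Finset.univ fun j => a j • x j

theorem rowEval_cons_zero (a p : Fin n → ℝ) :
    rowEval a (fun j => toLex (Fin.cons (p j) 0 : Fin (m + 1) → ℝ)) =
      toLex (Fin.cons (a ⬝ᵥ p) 0) := by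
  refine funext fun k => ?_
  refine (Finset.sum_apply k Finset.univ fun j => _).trans ?_
  refine Fin.cases ?_ (fun k => ?_) k
  · rfl
  · exact Finset.sum_eq_zero fun j _ => mul_zero (a j)

theorem toLex_le_of_apply_zero_lt {x y : Lex (Fin (m + 1) → ℝ)} (h : x 0 < y 0) : x ≤ y :=
  le_of_lt ⟨0, fun j hj => absurd hj (Fin.not_lt_zero j), h⟩

/-- Every point `p` of the polyhedron is the unperturbed part of a point of the perturbed polyhedron
at which a basis of the span of the constraints tight at `p` is tight. -/
theorem exists_perturbed_lift {p : Fin n → ℝ} (hp : p ∈ polyhedron A b) :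
    ∃ x : Fin n → Lex (Fin (m + 1) → ℝ), (∀ i, toLex (perturbed b i) ≤ rowEval (A i) x) ∧
      (∀ j, x j 0 = p j) ∧ ∃ H : Finset (Fin m),
        (∀ i ∈ H, rowEval (A i) x = toLex (perturbed b i)) ∧
        LinearIndepOn ℝ A (H : Set (Fin m)) ∧
        ∀ i, A i ⬝ᵥ p = b i → A i ∈ Submodule.span ℝ (A '' H) := by
  classical
  obtain ⟨x, hx, H, hHS, htight, hind, hspan⟩ := exists_basic_solution A
    (fun i => toLex (perturbed b i)) (Finset.univ.filter fun i => A i ⬝ᵥ p = b i)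
    ⟨fun j => toLex (Fin.cons (p j) 0), fun i _ => by
      rw [rowEval_cons_zero]
      refine (toLex_perturbed_le i).trans (Pi.toLex_monotone fun k => ?_)
      exact Fin.cases (hp i) (fun k => le_rfl) k⟩
  simp only [Finset.mem_filter, Finset.mem_univ, true_and] at hx hspan
  have hS : ∀ i ∈ H, A i ⬝ᵥ p = b i := fun i hi => (Finset.mem_filter.1 (hHS hi)).2
  -- The unperturbed part of `x` satisfies the same tight equations as `p`; it is moved to `p` along
  -- a direction orthogonal to the tight constraints, which leaves their slacks unchanged.
  let d : Fin n → ℝ := fun j => p j - x j 0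
  let e : Lex (Fin (m + 1) → ℝ) := toLex (Fin.cons 1 0)
  have hd : ∀ i, A i ⬝ᵥ p = b i → A i ⬝ᵥ d = 0 := by
    intro i hi
    have hle : Submodule.span ℝ (A '' H) ≤ LinearMap.ker ((dotProductBilin ℝ ℝ).flip d) := by
      refine Submodule.span_le.2 ?_
      rintro _ ⟨k, hk, rfl⟩
      have h1 : rowEval (A k) x 0 = b k := congrFun (htight k hk) 0
      rw [rowEval_apply_zero] at h1
      change A k ⬝ᵥ (p - fun j => x j 0) = 0
      rw [dotProduct_sub, h1, hS k hk, sub_self]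
    exact hle (hspan i hi)
  have hhead : ∀ j, (x j + d j • e) 0 = p j := fun j => by
    change x j 0 + (p j - x j 0) * 1 = p j
    ring
  have heval : ∀ i, A i ⬝ᵥ p = b i → rowEval (A i) (fun j => x j + d j • e) = rowEval (A i) x :=
    fun i hi => by rw [rowEval_add_smul, hd i hi, zero_smul, add_zero]
  refine ⟨fun j => x j + d j • e, fun i => ?_, hhead, H,
    fun i hi => (heval i (hS i hi)).trans (htight i hi), hind, hspan⟩
  rcases (hp i).eq_or_lt with h | h
  · rw [heval i h.symm]
    exact hx i h.symm
  · refine toLex_le_of_apply_zero_lt ?_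
    rw [rowEval_apply_zero, funext hhead]
    exact h

/-- Independent rows with trivial common kernel form a basis, hence are `n` in number. -/
theorem card_eq_of_forall_eq_zero {H : Finset (Fin m)} (hH : LinearIndepOn ℝ A (H : Set (Fin m)))
    (hz : ∀ z : Fin n → ℝ, (∀ y ∈ Submodule.span ℝ (A '' H), y ⬝ᵥ z = 0) → z = 0) :
    H.card = n := by
  have htop : Submodule.span ℝ (A '' H) = ⊤ := by
    refine (Submodule.eq_top_iff').2 fun a => ?_
    by_contra ha
    obtain ⟨z, hz', haz⟩ := exists_dotProduct_neg_of_notMem ha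
    rw [hz z hz', dotProduct_zero] at haz
    exact haz.false
  have h := finrank_span_eq_card hH.linearIndependent
  have himage : Set.range (fun i : (H : Set (Fin m)) => A i) = A '' H :=
    (Set.image_eq_range A H).symm
  rw [himage, htop, finrank_top, Module.finrank_fin_fun] at h
  simpa using h.symm

/-- At a vertex the tight constraints span the whole space, so the basis of tight rows provided by
the perturbed point over the vertex has `n` elements. -/
theorem exists_basis_of_isVertex {v : Fin n → ℝ} (hv : IsVertex (polyhedron A b) v) :
    ∃ I : RowSet m n, IsLexFeasibleBasis A b I ∧ unperturb (basicPoint A b I) = v := by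
  have hvP : v ∈ polyhedron A b := by
    obtain ⟨⟨-, c, hc⟩, -⟩ := hv
    exact (hc.subset rfl).1
  obtain ⟨x, hx, hhead, H, htight, hind, hspan⟩ := exists_perturbed_lift hvP
  have hcard : H.card = n := by
    refine card_eq_of_forall_eq_zero hind fun z hz => ?_
    obtain ⟨ε, hε, hmem⟩ := hv.1.exists_pos_add_smul_mem (z := z) rfl fun i hi => hz _ (hspan i hi)
    simpa [hε.ne'] using hmem
  obtain ⟨h1, h2⟩ := isLexFeasibleBasis_of_tight (X := Matrix.of fun j => ofLex (x j)) hx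
    (I := ⟨H, hcard⟩) hind htight
  refine ⟨_, h1, ?_⟩
  rw [h2]
  exact funext hhead

/-- The perturbed line over an edge `[v, w]` leaves the perturbed polyhedron, in the direction from
`v` to `w`, at the basic point of a lex-feasible basis lying over `w`. -/
theorem exists_basis_of_isFace_segment {v w p : Fin n → ℝ} (hvw : v ≠ w)
    (hF : IsFace (polyhedron A b) (segment ℝ v w)) (hp : p ∈ segment ℝ v w)
    {x : Fin n → Lex (Fin (m + 1) → ℝ)} (hx : ∀ i, toLex (perturbed b i) ≤ rowEval (A i) x)
    (hhead : ∀ j, x j 0 = p j) {H : Finset (Fin m)}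
    (htight : ∀ i ∈ H, rowEval (A i) x = toLex (perturbed b i))
    (hind : LinearIndepOn ℝ A (H : Set (Fin m)))
    (hspan : ∀ i, A i ⬝ᵥ p = b i → A i ∈ Submodule.span ℝ (A '' H))
    (hHd : ∀ i ∈ H, A i ⬝ᵥ (w - v) = 0) :
    ∃ i, A i ⬝ᵥ (w - v) < 0 ∧ ∃ I : RowSet m n, I.1 = insert i H ∧
      IsLexFeasibleBasis A b I ∧ unperturb (basicPoint A b I) = w := by
  have hd : w - v ≠ 0 := sub_ne_zero.2 hvw.symm
  obtain ⟨c, hc⟩ := hF.2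
  have hsub : ∀ y ∈ segment ℝ v w, y ∈ polyhedron A b ∧ ∀ z ∈ polyhedron A b, c ⬝ᵥ y ≤ c ⬝ᵥ z :=
    fun y hy => hc.subset hy
  have hv := hsub v (left_mem_segment ℝ v w)
  have hw := hsub w (right_mem_segment ℝ v w)
  have hcd : c ⬝ᵥ (w - v) = 0 := by
    rw [dotProduct_sub, sub_eq_zero]
    exact le_antisymm (hw.2 v hv.1) (hv.2 w hw.1)
  have hpoint : ∀ y ∈ segment ℝ v w, ∀ s : ℝ, y + s • (w - v) ∈ polyhedron A b →
      y + s • (w - v) ∈ segment ℝ v w := by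
    intro y hy s h
    rw [hc]
    refine ⟨h, fun z hz => ?_⟩
    rw [dotProduct_add, dotProduct_smul, hcd, smul_zero, add_zero]
    exact (hsub y hy).2 z hz
  have hneg : ∃ i ∈ Finset.univ, A i ⬝ᵥ (w - v) < 0 := by
    by_contra! hcon
    have hmem := hpoint w (right_mem_segment ℝ v w) 1 fun i => by
      have h : A i ⬝ᵥ (w + (1 : ℝ) • (w - v)) = A i ⬝ᵥ w + A i ⬝ᵥ (w - v) := by
        rw [one_smul, dotProduct_add]
      change b i ≤ A i ⬝ᵥ (w + (1 : ℝ) • (w - v))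
      rw [h]
      exact (hw.1 i).trans (le_add_of_nonneg_right (hcon i (Finset.mem_univ i)))
    rw [segment_eq_image'] at hmem
    obtain ⟨s, ⟨-, hs⟩, h⟩ := hmem
    dsimp only at h
    have h' : (2 - s) • (w - v) = 0 := by
      linear_combination (norm := module) -h
    exact (smul_ne_zero (by linarith) hd) h'
  obtain ⟨t, hfeas, i, -, hid, hi⟩ := exists_step_tight A (fun i => toLex (perturbed b i))
    Finset.univ x (fun i _ => hx i) (w - v) hneg
  set x' := fun j => x j + (w - v) j • t with hx'
  have hiH : A i ∉ Submodule.span ℝ (A '' H) := by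
    have hle : Submodule.span ℝ (A '' H) ≤ LinearMap.ker ((dotProductBilin ℝ ℝ).flip (w - v)) := by
      refine Submodule.span_le.2 ?_
      rintro _ ⟨k, hk, rfl⟩
      exact hHd k hk
    exact fun h => hid.ne (hle h)
  have hind' : LinearIndepOn ℝ A ((insert i H : Finset (Fin m)) : Set (Fin m)) := by
    rw [Finset.coe_insert]
    exact hind.insert hiH
  have hcard : (insert i H).card = n := by
    refine card_eq_of_forall_eq_zero hind' fun z hz => ?_
    -- `z` is orthogonal to all constraints tight at `p`, so it is parallel to the edge; but it is
    -- also orthogonal to the row `i`, which the edge is not.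
    have hzH : ∀ k, A k ⬝ᵥ p = b k → A k ⬝ᵥ z = 0 := fun k hk =>
      hz _ (Submodule.span_mono (Set.image_mono (by simp)) (hspan k hk))
    obtain ⟨ε, hε, hmem⟩ := hF.exists_pos_add_smul_mem hp hzH
    rw [segment_eq_image'] at hmem hp
    obtain ⟨s, -, hs⟩ := hp
    obtain ⟨r, -, hr⟩ := hmem
    dsimp only at hs hr
    have hzd : z = (ε⁻¹ * (r - s)) • (w - v) := by
      have h : ε • z = (r - s) • (w - v) := by
        linear_combination (norm := module) hs - hr
      rw [mul_smul, ← h, inv_smul_smul₀ hε.ne']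
    have hiz : A i ⬝ᵥ z = 0 := hz _ (Submodule.subset_span ⟨i, by simp, rfl⟩)
    rw [hzd, dotProduct_smul, smul_eq_mul, mul_eq_zero, or_iff_left hid.ne] at hiz
    rw [hzd, hiz, zero_smul]
  obtain ⟨h1, h2⟩ := isLexFeasibleBasis_of_tight (X := Matrix.of fun j => ofLex (x' j))
    (fun k => hfeas k (Finset.mem_univ k)) (I := ⟨insert i H, hcard⟩) hind' (by
      intro k hk
      rcases Finset.mem_insert.1 hk with rfl | hk
      · exact hi
      · refine (rowEval_add_smul _ _ _ _).trans ?_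
        rw [hHd k hk, zero_smul, add_zero, htight k hk])
  refine ⟨i, hid, _, rfl, h1, ?_⟩
  have hI := h1.unperturb_mem
  have hIi := dotProduct_unperturb_basicPoint (b := b) h1.1 (Finset.mem_insert_self i H)
  have hpt : unperturb (basicPoint A b ⟨insert i H, hcard⟩) = p + (t 0) • (w - v) := by
    rw [h2]
    funext j
    change x j 0 + (w - v) j * t 0 = p j + t 0 * (w - v) j
    rw [hhead, mul_comm]
  rw [hpt] at hI hIi ⊢
  have hmem := hpoint p hp _ hI
  rw [segment_eq_image'] at hmem
  obtain ⟨s, ⟨-, hs⟩, h⟩ := hmem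
  dsimp only at h
  rw [← h] at hIi ⊢
  -- The point is `v + s • (w - v)` with `s ≤ 1`, and `w` satisfies the constraint `i`, which is
  -- tight at the point and decreases towards `w`; so `s = 1`.
  have hwi : b i ≤ A i ⬝ᵥ w := hw.1 i
  rw [dotProduct_add, dotProduct_smul, smul_eq_mul] at hIi
  have hsplit : A i ⬝ᵥ w = A i ⬝ᵥ v + A i ⬝ᵥ (w - v) := by rw [dotProduct_sub]; ring
  have : s = 1 := le_antisymm hs (by nlinarith)
  rw [this, one_smul, add_sub_cancel]

/-- Over the midpoint of an edge there is a point of the perturbed polyhedron with `n - 1` independent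
tight rows, whose common kernel is the direction of the edge. Following the line they cut out both
ways adds one row at each end, and the two resulting bases are adjacent. -/
theorem exists_adjacent_bases {v w : Fin n → ℝ}
    (h : IsFaceOfDim (polyhedron A b) 1 (segment ℝ v w)) :
    v ≠ w ∧ ∃ I J : RowSet m n, (lexGraph A b).Adj I J ∧
      unperturb (basicPoint A b I) = v ∧ unperturb (basicPoint A b J) = w := by
  have hvw : v ≠ w := by
    rintro rfl
    have h2 := h.2
    rw [segment_same, direction_affineSpan, vectorSpan_singleton, finrank_bot] at h2
    exact zero_ne_one h2
  have hF := h.1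
  have hsubP : segment ℝ v w ⊆ polyhedron A b := by
    obtain ⟨-, c, hc⟩ := hF
    rw [hc]
    exact fun y hy => hy.1
  have hp : midpoint ℝ v w ∈ segment ℝ v w := midpoint_mem_segment v w
  obtain ⟨x, hx, hhead, H, htight, hind, hspan⟩ := exists_perturbed_lift (hsubP hp)
  -- A constraint that is tight at the midpoint is tight along the whole segment.
  have hHd : ∀ i ∈ H, A i ⬝ᵥ (w - v) = 0 := by
    intro i hi
    have h1 : rowEval (A i) x 0 = b i := congrFun (htight i hi) 0
    rw [rowEval_apply_zero, funext hhead] at h1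
    have hv : b i ≤ A i ⬝ᵥ v := hsubP (left_mem_segment ℝ v w) i
    have hw : b i ≤ A i ⬝ᵥ w := hsubP (right_mem_segment ℝ v w) i
    change A i ⬝ᵥ midpoint ℝ v w = b i at h1
    rw [midpoint_eq_smul_add, dotProduct_smul, dotProduct_add, smul_eq_mul, invOf_eq_inv] at h1
    rw [dotProduct_sub]
    linarith
  obtain ⟨j, hj, J, hJ, hJlex, hJw⟩ := exists_basis_of_isFace_segment hvw hF hp hx hhead htight
    hind hspan hHd
  rw [segment_symm] at hF hp
  obtain ⟨i, hi, I, hI, hIlex, hIv⟩ := exists_basis_of_isFace_segment hvw.symm hF hp hx hhead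
    htight hind hspan fun k hk => by rw [← neg_sub, dotProduct_neg, hHd k hk, neg_zero]
  rw [← neg_sub, dotProduct_neg, neg_lt_zero] at hi
  refine ⟨hvw, I, J, ⟨hIlex, hJlex, ?_⟩, hIv, hJw⟩
  have hjH : j ∉ H := fun h => hj.ne (hHd j h)
  have hiJ : i ∉ insert j H := by
    rw [Finset.mem_insert, not_or]
    exact ⟨by rintro rfl; exact hi.not_gt hj, fun h => hi.ne' (hHd i h)⟩
  rw [hI, hJ, Finset.insert_inter_of_notMem hiJ, Finset.inter_eq_left.2 (Finset.subset_insert j H),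
    ← Finset.card_insert_of_notMem hjH, ← hJ, J.2]

end LexGraph

theorem theorem3 (m n : ℕ) (A : Matrix (Fin m) (Fin n) ℝ) (b : Fin m → ℝ)
    (hP : Bornology.IsBounded (LexGraph.polyhedron A b)) :
    LexGraph.vertexEdgeGraph (LexGraph.polyhedron A b) =
      (LexGraph.lexGraph A b).image
        (fun I => LexGraph.unperturb (LexGraph.basicPoint A b I)) := by
  refine LexGraph.UGraph.ext (Set.ext fun v => ⟨?_, ?_⟩) (funext₂ fun v w => propext ⟨?_, ?_⟩)
  · exact fun hv => LexGraph.exists_basis_of_isVertex hv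
  · rintro ⟨I, hI, rfl⟩
    exact hI.isVertex
  · rintro ⟨-, -, h⟩
    obtain ⟨hne, I, J, hIJ, rfl, rfl⟩ := LexGraph.exists_adjacent_bases h
    exact ⟨I, J, hIJ, hne, rfl, rfl⟩
  · rintro ⟨I, J, ⟨hI, hJ, hIJ⟩, hne, rfl, rfl⟩
    exact ⟨hI.isVertex, hJ.isVertex, LexGraph.isFaceOfDim_segment hI hJ hIJ hne⟩
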